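/- Let $n\ge 1$ and let $d=(d_1,\dots,d_n)$, with $d_1\ge\dots\ge d_n$, be the degree sequence of a finite simple graph. A realization of $d$ is a simple graph with vertex set $\{1,\dots,n\}$ in which vertex $i$ has degree $d_i$ for every $i$. If $a,b,c,e$ are four distinct vertices of a graph $G$ such that $ab$ and $ce$ are edges of $G$ while $ae$ and $bc$ are not, then deleting the edges $ab,ce$ and adding the edges $ae,bc$ is called a $2$-switch in $G$. The realization graph $\mathscr{G}(d)$ has as its vertices all realizations of $d$, two of them being adjacent if and only if some $2$-switch changes one into the other. If $\mathscr{G}(d)$ is triangle-free, then $\mathscr{G}(d)$ is isomorphic to $K_1$, or is isomorphic to $K_2$, or has a Hamiltonian cycle. -/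

import Mathlib

namespace RealizationGraph

/-- The graph obtained from `G` by deleting the edges `ab`, `cd` and adding the edges `ad`, `bc`. -/
def switch {V : Type*} (G : SimpleGraph V) (a b c d : V) : SimpleGraph V :=
  G.deleteEdges {s(a, b), s(c, d)} ⊔ SimpleGraph.fromEdgeSet {s(a, d), s(b, c)}

/-- Some `2`-switch changes `G` into `G'`: there are four distinct vertices `a, b, c, d` such that
`ab` and `cd` are edges of `G`, `ad` and `bc` are not, and replacing the former two by the latter
two turns `G` into `G'`. -/
def TwoSwitch {V : Type*} (G G' : SimpleGraph V) : Prop :=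
  ∃ a b c d : V, a ≠ b ∧ a ≠ c ∧ a ≠ d ∧ b ≠ c ∧ b ≠ d ∧ c ≠ d ∧
    G.Adj a b ∧ G.Adj c d ∧ ¬ G.Adj a d ∧ ¬ G.Adj b c ∧ G' = switch G a b c d

theorem switch_adj {V : Type*} (G : SimpleGraph V) (a b c d x y : V) :
    (switch G a b c d).Adj x y ↔
      (G.Adj x y ∧ ¬ (s(x, y) = s(a, b) ∨ s(x, y) = s(c, d))) ∨
      ((s(x, y) = s(a, d) ∨ s(x, y) = s(b, c)) ∧ x ≠ y) := by
  simp [switch, SimpleGraph.sup_adj, SimpleGraph.deleteEdges_adj, SimpleGraph.fromEdgeSet_adj]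

theorem TwoSwitch.symm {V : Type*} {G G' : SimpleGraph V} (h : TwoSwitch G G') :
    TwoSwitch G' G := by
  obtain ⟨a, b, c, d, hab, hac, had, hbc, hbd, hcd, h1, h2, h3, h4, rfl⟩ := h
  refine ⟨a, d, c, b, had, hac, hab, hcd.symm, hbd.symm, hbc.symm, ?_, ?_, ?_, ?_, ?_⟩
  · rw [switch_adj]; exact Or.inr ⟨Or.inl rfl, had⟩
  · rw [switch_adj]; exact Or.inr ⟨Or.inr Sym2.eq_swap, hbc.symm⟩
  · rw [switch_adj]; simp; tauto
  · rw [switch_adj]; simp; tauto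
  · ext x y
    rw [switch_adj, switch_adj]
    have := h1.symm
    have := h2.symm
    have := mt (fun h : G.Adj d a => h.symm) h3
    have := mt (fun h : G.Adj c b => h.symm) h4
    simp only [Sym2.eq_iff]
    have := G.ne_of_adj (a := x) (b := y)
    grind

theorem TwoSwitch.irrefl {V : Type*} (G : SimpleGraph V) : ¬ TwoSwitch G G := by
  rintro ⟨a, b, c, d, -, -, had, -, -, -, -, -, h3, -, h⟩
  apply h3
  rw [h, switch_adj]
  exact Or.inr ⟨Or.inl rfl, had⟩

open Classical in
/-- The realizations of `d = (d₁, …, dₙ)`: the graphs on the vertex set `[n]` in which the vertex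
`i` has degree `dᵢ` for every `i`. -/
def Realization {n : ℕ} (d : Fin n → ℕ) : Type :=
  {G : SimpleGraph (Fin n) // ∀ i, G.degree i = d i}

/-- `d` is the degree sequence, in descending order, of a simple graph. -/
def IsDegreeSequence {n : ℕ} (d : Fin n → ℕ) : Prop :=
  Antitone d ∧ Nonempty (Realization d)

/-- The realization graph of `d`: its vertices are the realizations of `d`, two of them being
adjacent when some `2`-switch changes one into the other. -/
def realizationGraph {n : ℕ} (d : Fin n → ℕ) : SimpleGraph (Realization d) where
  Adj G G' := TwoSwitch G.1 G'.1
  symm := ⟨fun _ _ h => h.symm⟩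
  loopless := ⟨fun G h => TwoSwitch.irrefl G.1 h⟩

end RealizationGraph

namespace RealizationGraph

variable {V : Type*}

/-- `ab` and `cd` are edges of `G`, while `ad` and `bc` are two distinct vertices each and not
edges. -/
def AlternatingCycle (G : SimpleGraph V) (a b c d : V) : Prop :=
  a ≠ d ∧ b ≠ c ∧ G.Adj a b ∧ G.Adj c d ∧ ¬ G.Adj a d ∧ ¬ G.Adj b c

namespace AlternatingCycle

variable {G : SimpleGraph V} {a b c d : V}

theorem ne_ac (h : AlternatingCycle G a b c d) : a ≠ c := by
  rintro rfl; exact h.2.2.2.2.2 h.2.2.1.symm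

theorem ne_bd (h : AlternatingCycle G a b c d) : b ≠ d := by
  rintro rfl; exact h.2.2.2.2.1 h.2.2.1

theorem rotate (h : AlternatingCycle G a b c d) : AlternatingCycle G c d a b :=
  ⟨h.2.1.symm, h.1.symm, h.2.2.2.1, h.2.2.1, fun e => h.2.2.2.2.2 e.symm,
    fun e => h.2.2.2.2.1 e.symm⟩

theorem reflect (h : AlternatingCycle G a b c d) : AlternatingCycle G b a d c :=
  ⟨h.2.1, h.1, h.2.2.1.symm, h.2.2.2.1.symm, h.2.2.2.2.2, h.2.2.2.2.1⟩

theorem twoSwitch (h : AlternatingCycle G a b c d) : TwoSwitch G (switch G a b c d) :=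
  ⟨a, b, c, d, h.2.2.1.ne, h.ne_ac, h.1, h.2.1, h.ne_bd, h.2.2.2.1.ne, h.2.2.1, h.2.2.2.1,
    h.2.2.2.2.1, h.2.2.2.2.2, rfl⟩

end AlternatingCycle

theorem TwoSwitch.exists_alternatingCycle {G G' : SimpleGraph V} (h : TwoSwitch G G') :
    ∃ a b c d, AlternatingCycle G a b c d ∧ G' = switch G a b c d := by
  obtain ⟨a, b, c, d, hab, hac, had, hbc, hbd, hcd, h1, h2, h3, h4, h5⟩ := h
  exact ⟨a, b, c, d, ⟨had, hbc, h1, h2, h3, h4⟩, h5⟩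

theorem switch_rotate (G : SimpleGraph V) (a b c d : V) :
    switch G c d a b = switch G a b c d := by
  ext x y
  rw [switch_adj, switch_adj, Sym2.eq_swap (a := c) (b := b), Sym2.eq_swap (a := d) (b := a)]
  tauto

theorem switch_reflect (G : SimpleGraph V) (a b c d : V) :
    switch G b a d c = switch G a b c d := by
  ext x y
  rw [switch_adj, switch_adj, Sym2.eq_swap (a := b) (b := a), Sym2.eq_swap (a := d) (b := c)]
  tauto

theorem switch_neighborSet_left {G : SimpleGraph V} {a b c d : V}
    (h : AlternatingCycle G a b c d) :
    (switch G a b c d).neighborSet a = insert d (G.neighborSet a \ {b}) := by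
  have h1 := h.ne_ac
  obtain ⟨h2, h3, h4, h5, h6, h7⟩ := h
  ext x
  simp only [SimpleGraph.mem_neighborSet, switch_adj, Set.mem_insert_iff, Set.mem_sdiff,
    Set.mem_singleton_iff, Sym2.eq_iff]
  have := h4.ne
  grind

theorem ncard_neighborSet_switch_left [Finite V] {G : SimpleGraph V} {a b c d : V}
    (h : AlternatingCycle G a b c d) :
    ((switch G a b c d).neighborSet a).ncard = (G.neighborSet a).ncard := by
  rw [switch_neighborSet_left h]
  exact Set.ncard_exchange h.2.2.2.2.1 h.2.2.1

theorem ncard_neighborSet_switch [Finite V] {G : SimpleGraph V} {a b c d : V}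
    (h : AlternatingCycle G a b c d) (x : V) :
    ((switch G a b c d).neighborSet x).ncard = (G.neighborSet x).ncard := by
  by_cases ha : x = a
  · rw [ha]; exact ncard_neighborSet_switch_left h
  by_cases hc : x = c
  · rw [hc, ← switch_rotate]; exact ncard_neighborSet_switch_left h.rotate
  by_cases hb : x = b
  · rw [hb, ← switch_reflect]; exact ncard_neighborSet_switch_left h.reflect
  by_cases hd : x = d
  · rw [hd, ← switch_rotate, ← switch_reflect]
    exact ncard_neighborSet_switch_left h.rotate.reflect
  congr 1
  ext y
  simp only [SimpleGraph.mem_neighborSet, switch_adj, Sym2.eq_iff]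
  tauto

/-- The two properties that the absence of triangles in the realization graph forces upon every
alternating `4`-cycle `a, b, c, d`: every other vertex is adjacent to both or to neither of `a`,
`c`, and exactly one of `ac`, `bd` is an edge. -/
structure Rigid (G : SimpleGraph V) : Prop where
  adj_iff : ∀ a b c d, AlternatingCycle G a b c d → ∀ v, v ≠ a → v ≠ b → v ≠ c → v ≠ d →
    (G.Adj v a ↔ G.Adj v c)
  diag : ∀ a b c d, AlternatingCycle G a b c d → (G.Adj a c ↔ ¬ G.Adj b d)

theorem realization_ncard {n : ℕ} {d : Fin n → ℕ} (G : Realization d) (i : Fin n) :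
    (G.1.neighborSet i).ncard = d i := by
  classical
  rw [← G.2 i, Set.ncard_eq_toFinset_card', ← SimpleGraph.card_neighborFinset_eq_degree]
  congr!

/-- The realization of `d` obtained from another one by a `2`-switch. -/
def Realization.switch {n : ℕ} {d : Fin n → ℕ} (G : Realization d) {a b c e : Fin n}
    (h : AlternatingCycle G.1 a b c e) : Realization d :=
  ⟨RealizationGraph.switch G.1 a b c e, fun i => by
    classical
    rw [← realization_ncard G i, ← ncard_neighborSet_switch h i, Set.ncard_eq_toFinset_card',
      ← SimpleGraph.card_neighborFinset_eq_degree]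
    congr!⟩

theorem Realization.adj_switch {n : ℕ} {d : Fin n → ℕ} (G : Realization d) {a b c e : Fin n}
    (h : AlternatingCycle G.1 a b c e) : (realizationGraph d).Adj G (G.switch h) :=
  h.twoSwitch

theorem no_triangle {α : Type*} {Γ : SimpleGraph α} (h : Γ.CliqueFree 3) {x y z : α}
    (hxy : Γ.Adj x y) (hxz : Γ.Adj x z) (hyz : Γ.Adj y z) : False := by
  classical
  exact h {x, y, z} (SimpleGraph.is3Clique_triple_iff.2 ⟨hxy, hxz, hyz⟩)

theorem switch_switch_third {G : SimpleGraph V} {a b c d v : V}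
    (h : AlternatingCycle G a b c d) (hva : v ≠ a) (hvb : v ≠ b) (hvc : v ≠ c) (hvd : v ≠ d)
    (h1 : G.Adj v a) (h2 : ¬ G.Adj v c) :
    AlternatingCycle G a v c d ∧ AlternatingCycle (switch G a b c d) a v c b ∧
      switch (switch G a b c d) a v c b = switch G a v c d := by
  have hac := h.ne_ac
  have hbd := h.ne_bd
  obtain ⟨h3, h4, h5, h6, h7, h8⟩ := h
  have := h5.ne
  have := h6.ne
  have h9 : ¬ G.Adj c v := fun e => h2 e.symm
  have h10 : ¬ G.Adj c b := fun e => h8 e.symm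
  have h11 : ¬ G.Adj d a := fun e => h7 e.symm
  refine ⟨⟨h3, hvc, h1.symm, h6, h7, h2⟩, ⟨?_, ?_, ?_, ?_, ?_, ?_⟩, ?_⟩
  · assumption
  · assumption
  · rw [switch_adj, Sym2.eq_iff, Sym2.eq_iff, Sym2.eq_iff, Sym2.eq_iff]; have := h1.symm; grind
  · rw [switch_adj, Sym2.eq_iff, Sym2.eq_iff, Sym2.eq_iff, Sym2.eq_iff]; grind
  · rw [switch_adj, Sym2.eq_iff, Sym2.eq_iff, Sym2.eq_iff, Sym2.eq_iff]; grind
  · rw [switch_adj, Sym2.eq_iff, Sym2.eq_iff, Sym2.eq_iff, Sym2.eq_iff]; grind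
  · ext x y
    have := h1.symm
    have := h5.symm
    have := h6.symm
    have := G.ne_of_adj (a := x) (b := y)
    simp only [switch_adj, Sym2.eq_iff]
    grind

theorem switch_switch_diag {G : SimpleGraph V} {a b c d : V}
    (h : AlternatingCycle G a b c d) (h1 : ¬ G.Adj a c) (h2 : ¬ G.Adj b d) :
    AlternatingCycle G a b d c ∧ AlternatingCycle (switch G a b c d) a d b c ∧
      switch (switch G a b c d) a d b c = switch G a b d c := by
  have hac := h.ne_ac
  have hbd := h.ne_bd
  obtain ⟨h3, h4, h5, h6, h7, h8⟩ := h
  have := h5.ne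
  have := h6.ne
  have h10 : ¬ G.Adj c b := fun e => h8 e.symm
  have h11 : ¬ G.Adj d a := fun e => h7 e.symm
  have h12 : ¬ G.Adj c a := fun e => h1 e.symm
  have h13 : ¬ G.Adj d b := fun e => h2 e.symm
  refine ⟨⟨hac, hbd, h5, h6.symm, h1, h2⟩, ⟨?_, ?_, ?_, ?_, ?_, ?_⟩, ?_⟩
  · assumption
  · exact hbd.symm
  · rw [switch_adj, Sym2.eq_iff, Sym2.eq_iff, Sym2.eq_iff, Sym2.eq_iff]; grind
  · rw [switch_adj, Sym2.eq_iff, Sym2.eq_iff, Sym2.eq_iff, Sym2.eq_iff]; grind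
  · rw [switch_adj, Sym2.eq_iff, Sym2.eq_iff, Sym2.eq_iff, Sym2.eq_iff]; grind
  · rw [switch_adj, Sym2.eq_iff, Sym2.eq_iff, Sym2.eq_iff, Sym2.eq_iff]; grind
  · ext x y
    have := h5.symm
    have := h6.symm
    have := G.ne_of_adj (a := x) (b := y)
    simp only [switch_adj, Sym2.eq_iff]
    grind

theorem switch_switch_diag' {G : SimpleGraph V} {a b c d : V}
    (h : AlternatingCycle G a b c d) (h1 : G.Adj a c) (h2 : G.Adj b d) :
    AlternatingCycle G a c b d ∧ AlternatingCycle (switch G a b c d) a c d b ∧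
      switch (switch G a b c d) a c d b = switch G a c b d := by
  have hac := h.ne_ac
  have hbd := h.ne_bd
  obtain ⟨h3, h4, h5, h6, h7, h8⟩ := h
  have := h5.ne
  have := h6.ne
  have h10 : ¬ G.Adj c b := fun e => h8 e.symm
  have h11 : ¬ G.Adj d a := fun e => h7 e.symm
  have h12 := h1.symm
  have h13 := h2.symm
  refine ⟨⟨h3, h4.symm, h1, h2, h7, h10⟩, ⟨?_, ?_, ?_, ?_, ?_, ?_⟩, ?_⟩
  · assumption
  · assumption
  · rw [switch_adj, Sym2.eq_iff, Sym2.eq_iff, Sym2.eq_iff, Sym2.eq_iff]; grind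
  · rw [switch_adj, Sym2.eq_iff, Sym2.eq_iff, Sym2.eq_iff, Sym2.eq_iff]; grind
  · rw [switch_adj, Sym2.eq_iff, Sym2.eq_iff, Sym2.eq_iff, Sym2.eq_iff]; grind
  · rw [switch_adj, Sym2.eq_iff, Sym2.eq_iff, Sym2.eq_iff, Sym2.eq_iff]; grind
  · ext x y
    have := h5.symm
    have := h6.symm
    have := G.ne_of_adj (a := x) (b := y)
    simp only [switch_adj, Sym2.eq_iff]
    grind

theorem triangle_of_switch_switch {n : ℕ} {d : Fin n → ℕ}
    (htf : (realizationGraph d).CliqueFree 3) (G : Realization d)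
    {a b c e a' b' c' e' a'' b'' c'' e'' : Fin n} (h : AlternatingCycle G.1 a b c e)
    (h' : AlternatingCycle G.1 a' b' c' e' ∧
      AlternatingCycle (RealizationGraph.switch G.1 a b c e) a'' b'' c'' e'' ∧
      RealizationGraph.switch (RealizationGraph.switch G.1 a b c e) a'' b'' c'' e'' =
        RealizationGraph.switch G.1 a' b' c' e') : False := by
  obtain ⟨h1, h2, h3⟩ := h'
  refine no_triangle htf (G.adj_switch h) (G.adj_switch h1) ?_
  change TwoSwitch (RealizationGraph.switch G.1 a b c e) (RealizationGraph.switch G.1 a' b' c' e')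
  rw [← h3]
  exact h2.twoSwitch

theorem Realization.rigid {n : ℕ} {d : Fin n → ℕ}
    (htf : (realizationGraph d).CliqueFree 3) (G : Realization d) : Rigid G.1 where
  adj_iff a b c e h v hva hvb hvc hve := by
    by_contra hne
    by_cases h1 : G.1.Adj v a
    · exact triangle_of_switch_switch htf G h
        (switch_switch_third h hva hvb hvc hve h1 (by tauto))
    · exact triangle_of_switch_switch htf G h.rotate
        (switch_switch_third h.rotate hvc hve hva hvb (by tauto) h1)
  diag a b c e h := by
    by_contra hne
    by_cases h1 : G.1.Adj a c
    · exact triangle_of_switch_switch htf G h (switch_switch_diag' h h1 (by tauto))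
    · exact triangle_of_switch_switch htf G h (switch_switch_diag h h1 (by tauto))

section Rigid

variable {G : SimpleGraph V} {a b c d : V}

theorem exists_alternatingCycle_of_ncard_le [Finite V] {p b d : V}
    (hpb : G.Adj p b) (hpd : ¬ G.Adj p d) (hne : p ≠ d)
    (hle : (G.neighborSet b).ncard ≤ (G.neighborSet d).ncard) :
    ∃ c, AlternatingCycle G p b c d := by
  by_contra! hno
  have hbd : b ≠ d := by rintro rfl; exact hpd hpb
  have key : ∀ c, c ≠ b → G.Adj c d → G.Adj b c := by
    intro c hc hcd
    by_contra hbc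
    exact hno c ⟨hne, hc.symm, hpb, hcd, hpd, hbc⟩
  have hp : p ∉ G.neighborSet d := fun h => hpd h.symm
  by_cases hadj : G.Adj b d
  · have h1 : insert p (insert d (G.neighborSet d \ {b})) ⊆ G.neighborSet b := by
      rintro x (rfl | rfl | ⟨hx, hxb⟩)
      · exact hpb.symm
      · exact hadj
      · exact key x hxb hx.symm
    have h2 := Set.ncard_le_ncard h1 (Set.toFinite _)
    have h3 : (insert d (G.neighborSet d \ {b})).ncard = (G.neighborSet d).ncard :=
      Set.ncard_exchange G.irrefl hadj.symm
    rw [Set.ncard_insert_of_notMem (by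
      rintro (h | h)
      · exact hne h
      · exact hp h.1) (Set.toFinite _), h3] at h2
    omega
  · have h1 : insert p (G.neighborSet d) ⊆ G.neighborSet b := by
      rintro x (rfl | hx)
      · exact hpb.symm
      · exact key x (by rintro rfl; exact hadj hx.symm) hx.symm
    have h2 := Set.ncard_le_ncard h1 (Set.toFinite _)
    rw [Set.ncard_insert_of_notMem hp (Set.toFinite _)] at h2
    omega

theorem Rigid.adj_iff' (hG : Rigid G) (h : AlternatingCycle G a b c d) {v : V}
    (hva : v ≠ a) (hvb : v ≠ b) (hvc : v ≠ c) (hvd : v ≠ d) : G.Adj v b ↔ G.Adj v d :=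
  hG.adj_iff _ _ _ _ h.reflect v hvb hva hvd hvc

theorem Rigid.eq_of_adj_of_not_adj (hG : Rigid G) (h : AlternatingCycle G a b c d) {q : V}
    (hqb : G.Adj q b) (hqd : ¬ G.Adj q d) (hne : q ≠ d) : q = a := by
  by_contra hqa
  have hqc : q ≠ c := by rintro rfl; exact h.2.2.2.2.2 hqb.symm
  exact hqd ((hG.adj_iff' h hqa hqb.ne hqc hne).1 hqb)

/-- In an alternating `4`-cycle, exchanging `a` and `c` amounts to performing the `2`-switch. -/
theorem Rigid.switch_adj_swap [DecidableEq V] (hG : Rigid G) (h : AlternatingCycle G a b c d)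
    (x y : V) :
    (switch G a b c d).Adj (Equiv.swap a c x) (Equiv.swap a c y) ↔ G.Adj x y := by
  have hac := h.ne_ac
  have hbd := h.ne_bd
  have key := hG.adj_iff a b c d h
  obtain ⟨h3, h4, h5, h6, h7, h8⟩ := h
  have := h5.ne
  have := h6.ne
  have := h5.symm
  have := h6.symm
  have h10 : ¬ G.Adj c b := fun e => h8 e.symm
  have h11 : ¬ G.Adj d a := fun e => h7 e.symm
  have h12 : G.Adj a c ↔ G.Adj c a := G.adj_comm a c
  have hx := key x
  have hy := key y
  have := G.adj_comm x a
  have := G.adj_comm x c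
  have := G.adj_comm y a
  have := G.adj_comm y c
  have hxy := G.ne_of_adj (a := x) (b := y)
  have haa := G.irrefl (v := a)
  have hcc := G.irrefl (v := c)
  simp only [switch_adj, Sym2.eq_iff, Equiv.swap_apply_def]
  clear key
  by_cases hxa : x = a
  · subst hxa; grind
  by_cases hxc : x = c
  · subst hxc; grind
  by_cases hya : y = a
  · subst hya; grind
  by_cases hyc : y = c
  · subst hyc; grind
  simp only [hxa, hxc, hya, hyc, if_false]
  grind

end Rigid

section Exchange

theorem Rigid.ncard_eq {V : Type*} [Finite V] {G : SimpleGraph V} (hG : Rigid G) {a b c d : V}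
    (h : AlternatingCycle G a b c d) :
    (G.neighborSet a).ncard = (G.neighborSet c).ncard := by
  classical
  have h1 : (switch G a b c d).neighborSet c = Equiv.swap a c '' G.neighborSet a := by
    ext y
    rw [Equiv.image_eq_preimage_symm, Set.mem_preimage, SimpleGraph.mem_neighborSet,
      SimpleGraph.mem_neighborSet, ← hG.switch_adj_swap h, Equiv.symm_swap, Equiv.swap_apply_left,
      Equiv.swap_apply_self]
  rw [← ncard_neighborSet_switch h c, h1, Set.ncard_image_of_injective _ (Equiv.injective _)]

variable {n : ℕ} {d : Fin n → ℕ}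

/-- The realizations of `d` that agree with `K` on the first `m` pairs `(p, b)` in lexicographic
order. -/
def agreeing (m : ℕ) (K : Realization d) : Set (Realization d) :=
  {G | ∀ p b : Fin n, (p : ℕ) * n + b < m → (G.1.Adj p b ↔ K.1.Adj p b)}

theorem lex_lt {q p : Fin n} (h : q < p) (t s : Fin n) : (q : ℕ) * n + t < (p : ℕ) * n + s := by
  have h1 : (q : ℕ) + 1 ≤ p := h
  have h2 := Nat.mul_le_mul_right n h1
  have := t.2
  rw [Nat.add_mul] at h2
  omega

theorem exists_alternatingCycle_of_agree (htf : (realizationGraph d).CliqueFree 3)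
    {G H : Realization d} {p x y : Fin n} (hpx : G.1.Adj p x) (hpy : ¬ G.1.Adj p y)
    (hpx' : ¬ H.1.Adj p x) (hpy' : H.1.Adj p y)
    (hagree : ∀ q t, q < p → (G.1.Adj q t ↔ H.1.Adj q t)) :
    ∃ c, p < c ∧ AlternatingCycle G.1 p x c y := by
  have hG := G.rigid htf
  have hH := H.rigid htf
  obtain ⟨c, hc⟩ : ∃ c, AlternatingCycle G.1 p x c y := by
    apply exists_alternatingCycle_of_ncard_le hpx hpy hpy'.ne
    rw [realization_ncard, realization_ncard]
    by_contra! hlt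
    obtain ⟨c, hc⟩ := exists_alternatingCycle_of_ncard_le hpy' hpx' hpx.ne
      (by rw [realization_ncard, realization_ncard]; exact hlt.le)
    have := hH.ncard_eq hc.reflect
    rw [realization_ncard, realization_ncard] at this
    omega
  refine ⟨c, lt_of_le_of_ne (not_lt.1 fun hlt => ?_) hc.ne_ac, hc⟩
  have hcy : H.1.Adj c y := (hagree c y hlt).1 hc.2.2.2.1
  have hcx : ¬ H.1.Adj c x := fun h => hc.2.2.2.2.2 ((hagree c x hlt).2 h).symm
  obtain ⟨e, he⟩ := exists_alternatingCycle_of_ncard_le hpy' hpx' hpx.ne (by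
    have := hG.ncard_eq hc.reflect
    rw [realization_ncard, realization_ncard] at this ⊢
    exact this.ge)
  exact hc.ne_ac (hH.eq_of_adj_of_not_adj he hcy hcx hc.2.1.symm).symm

theorem switch_mem_agreeing {m : ℕ} {G K : Realization d} (hG : G ∈ agreeing m K)
    {p x c y : Fin n} (h : AlternatingCycle G.1 p x c y)
    (hpx : p < x) (hpc : p < c) (hpy : p < y)
    (hx : m ≤ (p : ℕ) * n + x) (hy : m ≤ (p : ℕ) * n + y) : G.switch h ∈ agreeing m K := by
  intro q t hqt
  rw [← hG q t hqt]
  change (RealizationGraph.switch G.1 p x c y).Adj q t ↔ _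
  have hqp : ¬ p < q := fun hlt => by have := lex_lt hlt x t; omega
  have h1 : ∀ z, p < z → q ≠ z := by rintro z hz rfl; exact hqp hz
  have h2 : ∀ z, q = p → m ≤ (p : ℕ) * n + z → t ≠ z := by rintro z rfl hz rfl; omega
  have := h1 _ hpx
  have := h1 _ hpc
  have := h1 _ hpy
  have := h2 x
  have := h2 y
  simp only [switch_adj, Sym2.eq_iff]
  grind

theorem exists_adj_mem_agreeing (htf : (realizationGraph d).CliqueFree 3)
    {p b : Fin n} {G H K : Realization d} (hG : G ∈ agreeing ((p : ℕ) * n + b) K)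
    (hH : H ∈ agreeing ((p : ℕ) * n + b) K) (hne : ¬ (G.1.Adj p b ↔ H.1.Adj p b)) :
    ∃ G' ∈ agreeing ((p : ℕ) * n + b) K, (realizationGraph d).Adj G G' ∧
      (G'.1.Adj p b ↔ H.1.Adj p b) := by
  have hagree : ∀ q t : Fin n, (q : ℕ) * n + t < (p : ℕ) * n + b →
      (G.1.Adj q t ↔ H.1.Adj q t) := fun q t h => (hG q t h).trans (hH q t h).symm
  have hagree' : ∀ q t, q < p → (G.1.Adj q t ↔ H.1.Adj q t) :=
    fun q t h => hagree q t (lex_lt h t b)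
  have hgt : ∀ y, ¬ (G.1.Adj p y ↔ H.1.Adj p y) → p < y ∧ (p : ℕ) * n + b ≤ (p : ℕ) * n + y := by
    intro y hy
    refine ⟨lt_of_not_ge fun hle => ?_, not_lt.1 fun hlt => hy (hagree p y hlt)⟩
    rcases hle.lt_or_eq with hlt | rfl
    · rw [G.1.adj_comm, H.1.adj_comm] at hy
      exact hy (hagree' y p hlt)
    · exact hy (by simp)
  have hex : ∀ {G H : Realization d}, G.1.Adj p b → ¬ H.1.Adj p b →
      ∃ y, H.1.Adj p y ∧ ¬ G.1.Adj p y := by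
    intro G H h1 h2
    by_contra! hsub
    have hsub' : H.1.neighborSet p ⊆ G.1.neighborSet p := hsub
    have := Set.eq_of_subset_of_ncard_le hsub'
      (by rw [realization_ncard, realization_ncard]) (Set.toFinite _)
    exact h2 (show b ∈ H.1.neighborSet p by rw [this]; exact h1)
  by_cases hb : G.1.Adj p b
  · have hb' : ¬ H.1.Adj p b := by tauto
    obtain ⟨y, hy, hy'⟩ := hex hb hb'
    obtain ⟨c, hpc, hc⟩ := exists_alternatingCycle_of_agree htf hb hy' hb' hy hagree'
    obtain ⟨h1, h2⟩ := hgt y (by tauto)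
    refine ⟨G.switch hc, switch_mem_agreeing hG hc (hgt b hne).1 hpc h1 le_rfl h2,
      G.adj_switch hc, iff_of_false ?_ hb'⟩
    change ¬ (RealizationGraph.switch G.1 p b c y).Adj p b
    have := hc.ne_ac
    have := hc.ne_bd
    simp only [switch_adj, Sym2.eq_iff]
    grind
  · have hb' : H.1.Adj p b := by tauto
    obtain ⟨x, hx, hx'⟩ := hex hb' hb
    obtain ⟨c, hpc, hc⟩ := exists_alternatingCycle_of_agree htf hx hb hx' hb' hagree'
    obtain ⟨h1, h2⟩ := hgt x (by tauto)
    refine ⟨G.switch hc, switch_mem_agreeing hG hc h1 hpc (hgt b hne).1 h2 le_rfl,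
      G.adj_switch hc, iff_of_true ?_ hb'⟩
    change (RealizationGraph.switch G.1 p x c b).Adj p b
    rw [switch_adj]
    exact Or.inr ⟨Or.inl rfl, hb'.ne⟩

end Exchange

section Laceable

variable {α : Type*} {Γ : SimpleGraph α} {col : α → Prop} {S S₁ S₂ : Set α}

/-- Both colours occur in `S`, and any two vertices in `S` of different colours are the ends of a
path that runs through exactly the vertices in `S`. -/
structure Laceable (Γ : SimpleGraph α) (col : α → Prop) (S : Set α) : Prop where
  exists_not_iff : ∀ x ∈ S, ∃ y ∈ S, ¬ (col x ↔ col y)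
  exists_path : ∀ x ∈ S, ∀ y ∈ S, ¬ (col x ↔ col y) →
    ∃ p : Γ.Walk x y, p.IsPath ∧ ∀ z, z ∈ p.support ↔ z ∈ S

theorem isPath_append_cons {x u v y : α} {p : Γ.Walk x u} {q : Γ.Walk v y} (h : Γ.Adj u v)
    (hp : p.IsPath) (hq : q.IsPath) (hpS : ∀ z, z ∈ p.support ↔ z ∈ S₁)
    (hqS : ∀ z, z ∈ q.support ↔ z ∈ S₂) (hd : Disjoint S₁ S₂) :
    (p.append (.cons h q)).IsPath ∧
      ∀ z, z ∈ (p.append (.cons h q)).support ↔ z ∈ S₁ ∪ S₂ := by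
  have hs : (p.append (.cons h q)).support = p.support ++ q.support := by
    simp [SimpleGraph.Walk.support_append]
  refine ⟨?_, fun z => by rw [hs, List.mem_append, hpS, hqS, Set.mem_union]⟩
  rw [SimpleGraph.Walk.isPath_def, hs]
  refine hp.support_nodup.append hq.support_nodup fun z h1 h2 => ?_
  exact Set.disjoint_left.1 hd ((hpS z).1 h1) ((hqS z).1 h2)

theorem Laceable.exists_path_union_of_mem_left (hcol : ∀ x y, Γ.Adj x y → ¬ (col x ↔ col y))
    (h₁ : Laceable Γ col S₁) (h₂ : Laceable Γ col S₂) (hd : Disjoint S₁ S₂)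
    (j₁ : ∀ x ∈ S₁, ∃ y ∈ S₂, Γ.Adj x y) {x y : α} (hx : x ∈ S₁) (hy : y ∈ S₁ ∪ S₂)
    (hxy : ¬ (col x ↔ col y)) :
    ∃ p : Γ.Walk x y, p.IsPath ∧ ∀ z, z ∈ p.support ↔ z ∈ S₁ ∪ S₂ := by
  rcases hy with hy | hy
  · obtain ⟨p, hp, hpS⟩ := h₁.exists_path x hx y hy hxy
    cases p with
    | nil => exact absurd Iff.rfl hxy
    | @cons _ v _ hadj t =>
      have hv : v ∈ S₁ := (hpS v).1 (by simp)
      obtain ⟨x', hx', hxx'⟩ := j₁ x hx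
      obtain ⟨v', hv', hvv'⟩ := j₁ v hv
      have c1 := hcol _ _ hadj
      have c2 := hcol _ _ hxx'
      have c3 := hcol _ _ hvv'
      obtain ⟨q, hq, hqS⟩ := h₂.exists_path x' hx' v' hv' (by tauto)
      rw [SimpleGraph.Walk.cons_isPath_iff] at hp
      obtain ⟨h3, h4⟩ := isPath_append_cons (S₁ := S₂) (S₂ := S₁ \ {x}) hvv'.symm hq hp.1 hqS
        (fun z => by
          have := hpS z
          simp only [SimpleGraph.Walk.support_cons, List.mem_cons] at this
          rw [Set.mem_sdiff, Set.mem_singleton_iff, ← this]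
          have := hp.2
          constructor
          · intro hz
            exact ⟨Or.inr hz, by rintro rfl; exact this hz⟩
          · tauto) (hd.symm.mono_right Set.sdiff_subset)
      refine ⟨.cons hxx' (q.append (.cons hvv'.symm t)), ?_, fun z => ?_⟩
      · rw [SimpleGraph.Walk.cons_isPath_iff]
        refine ⟨h3, fun hmem => ?_⟩
        rcases (h4 x).1 hmem with h5 | h5
        · exact Set.disjoint_left.1 hd hx h5
        · exact h5.2 rfl
      · rw [SimpleGraph.Walk.support_cons, List.mem_cons, h4]
        simp only [Set.mem_union, Set.mem_sdiff, Set.mem_singleton_iff]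
        by_cases hz : z = x
        · subst hz; tauto
        · tauto
  · obtain ⟨u, hu, hxu⟩ := h₁.exists_not_iff x hx
    obtain ⟨u', hu', huu'⟩ := j₁ u hu
    have c1 := hcol _ _ huu'
    obtain ⟨p, hp, hpS⟩ := h₁.exists_path x hx u hu hxu
    obtain ⟨q, hq, hqS⟩ := h₂.exists_path u' hu' y hy (by tauto)
    exact ⟨_, isPath_append_cons huu' hp hq hpS hqS hd⟩

theorem Laceable.union (hcol : ∀ x y, Γ.Adj x y → ¬ (col x ↔ col y))
    (h₁ : Laceable Γ col S₁) (h₂ : Laceable Γ col S₂) (hd : Disjoint S₁ S₂)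
    (j₁ : ∀ x ∈ S₁, ∃ y ∈ S₂, Γ.Adj x y) (j₂ : ∀ x ∈ S₂, ∃ y ∈ S₁, Γ.Adj x y) :
    Laceable Γ col (S₁ ∪ S₂) where
  exists_not_iff := by
    rintro x (hx | hx)
    · obtain ⟨y, hy, h⟩ := h₁.exists_not_iff x hx
      exact ⟨y, Or.inl hy, h⟩
    · obtain ⟨y, hy, h⟩ := h₂.exists_not_iff x hx
      exact ⟨y, Or.inr hy, h⟩
  exists_path x hx y hy hxy := by
    rcases hx with hx | hx
    · exact h₁.exists_path_union_of_mem_left hcol h₂ hd j₁ hx hy hxy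
    · rw [Set.union_comm] at hy ⊢
      exact h₂.exists_path_union_of_mem_left hcol h₁ hd.symm j₂ hx hy hxy

theorem laceable_pair (hcol : ∀ x y, Γ.Adj x y → ¬ (col x ↔ col y)) {u v : α} (h : Γ.Adj u v) :
    Laceable Γ col {u, v} where
  exists_not_iff := by
    have := hcol _ _ h
    rintro x (rfl | rfl)
    · exact ⟨v, by simp, this⟩
    · exact ⟨u, by simp, by tauto⟩
  exists_path := by
    rintro x (rfl | rfl) y (rfl | rfl) hxy
    · exact absurd Iff.rfl hxy
    · exact ⟨.cons h .nil, by simp [h.ne], by simp⟩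
    · exact ⟨.cons h.symm .nil, by simp [h.ne'], by simp [or_comm]⟩
    · exact absurd Iff.rfl hxy

theorem Laceable.exists_adj (h : Laceable Γ col S) (hne : S.Nonempty) :
    ∃ x ∈ S, ∃ y ∈ S, Γ.Adj x y := by
  obtain ⟨x, hx⟩ := hne
  obtain ⟨y, hy, hxy⟩ := h.exists_not_iff x hx
  obtain ⟨p, -, hpS⟩ := h.exists_path x hx y hy hxy
  cases p with
  | nil => exact absurd Iff.rfl hxy
  | @cons _ v _ hadj t => exact ⟨x, hx, v, (hpS v).1 (by simp), hadj⟩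

theorem Laceable.not_singleton (htf : Γ.CliqueFree 3) (h : Laceable Γ col S) (hne : S.Nonempty)
    {u : α} (j : ∀ x ∈ S, Γ.Adj x u) : False := by
  obtain ⟨x, hx, y, hy, hxy⟩ := h.exists_adj hne
  exact no_triangle htf hxy (j x hx) (j y hy)

end Laceable

theorem agreeing_eq_singleton_or_laceable {n : ℕ} {d : Fin n → ℕ}
    (htf : (realizationGraph d).CliqueFree 3) {col : Realization d → Prop}
    (hcol : ∀ x y, (realizationGraph d).Adj x y → ¬ (col x ↔ col y)) (k : ℕ) :
    ∀ m, m + k = n * n → ∀ K : Realization d,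
      agreeing m K = {K} ∨ Laceable (realizationGraph d) col (agreeing m K) := by
  induction k with
  | zero =>
    intro m hm K
    left
    ext G
    refine ⟨fun hG => Subtype.ext ?_, ?_⟩
    · ext p b
      apply hG
      have h1 : (p : ℕ) + 1 ≤ n := p.2
      have h2 := Nat.mul_le_mul_right n h1
      have := b.2
      rw [Nat.add_mul] at h2
      omega
    · rintro rfl
      exact fun _ _ _ => Iff.rfl
  | succ k ih =>
    intro m hm K
    obtain ⟨p, b, hpb⟩ : ∃ p b : Fin n, m = (p : ℕ) * n + b := by
      have hlt : m < n * n := by omega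
      have hn : 0 < n := by
        rcases Nat.eq_zero_or_pos n with rfl | h
        · omega
        · exact h
      exact ⟨⟨m / n, Nat.div_lt_of_lt_mul hlt⟩, ⟨m % n, Nat.mod_lt _ hn⟩,
        (Nat.div_add_mod' m n).symm⟩
    have hstep : ∀ {L G : Realization d}, L ∈ agreeing m K →
        (G ∈ agreeing (m + 1) L ↔ G ∈ agreeing m K ∧ (G.1.Adj p b ↔ L.1.Adj p b)) := by
      intro L G hL
      constructor
      · intro hG
        exact ⟨fun q t h => (hG q t (by omega)).trans (hL q t h), hG p b (by omega)⟩
      · rintro ⟨h1, h2⟩ q t h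
        rcases Nat.lt_succ_iff_lt_or_eq.1 h with h | h
        · exact (h1 q t h).trans (hL q t h).symm
        · obtain rfl : q = p := by
            rcases lt_trichotomy q p with hlt | rfl | hlt
            · have := lex_lt hlt t b; omega
            · rfl
            · have := lex_lt hlt b t; omega
          obtain rfl : t = b := Fin.ext (by omega)
          exact h2
    have hK : K ∈ agreeing m K := fun _ _ _ => Iff.rfl
    by_cases hall : ∀ G ∈ agreeing m K, (G.1.Adj p b ↔ K.1.Adj p b)
    · have : agreeing m K = agreeing (m + 1) K := by
        ext G
        rw [hstep hK]
        exact ⟨fun h => ⟨h, hall G h⟩, fun h => h.1⟩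
      rw [this]
      exact ih (m + 1) (by omega) K
    push Not at hall
    obtain ⟨H, hH, hne⟩ := hall
    replace hne : ¬ (H.1.Adj p b ↔ K.1.Adj p b) := by tauto
    have hjump : ∀ {L M : Realization d}, L ∈ agreeing m K → M ∈ agreeing m K →
        ¬ (L.1.Adj p b ↔ M.1.Adj p b) → ∀ G ∈ agreeing (m + 1) L, ∃ G' ∈ agreeing (m + 1) M,
          (realizationGraph d).Adj G G' := by
      intro L M hL hM hLM G hG
      rw [hstep hL] at hG
      obtain ⟨hG, hG'⟩ := hG
      have hGM : ¬ (G.1.Adj p b ↔ M.1.Adj p b) := by tauto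
      subst hpb
      obtain ⟨G', h1, h2, h3⟩ := exists_adj_mem_agreeing htf hG hM hGM
      exact ⟨G', (hstep hM).2 ⟨h1, h3⟩, h2⟩
    have hunion : agreeing m K = agreeing (m + 1) K ∪ agreeing (m + 1) H := by
      ext G
      rw [Set.mem_union, hstep hK, hstep hH, ← and_or_left]
      exact (and_iff_left (by tauto)).symm
    have hdisj : Disjoint (agreeing (m + 1) K) (agreeing (m + 1) H) := by
      rw [Set.disjoint_left]
      intro G h1 h2
      rw [hstep hK] at h1
      rw [hstep hH] at h2
      tauto
    have j₁ := hjump hK hH (by tauto)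
    have j₂ := hjump hH hK hne
    have neK : (agreeing (m + 1) K).Nonempty := ⟨K, fun _ _ _ => Iff.rfl⟩
    have neH : (agreeing (m + 1) H).Nonempty := ⟨H, fun _ _ _ => Iff.rfl⟩
    right
    rw [hunion]
    rcases ih (m + 1) (by omega) K with h1 | h1 <;> rcases ih (m + 1) (by omega) H with h2 | h2
    · rw [h1, h2] at j₁ ⊢
      obtain ⟨_, rfl, h3⟩ := j₁ K rfl
      exact laceable_pair hcol h3
    · refine (h2.not_singleton htf neH (u := K) fun x hx => ?_).elim
      obtain ⟨y, hy, h3⟩ := j₂ x hx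
      rw [h1] at hy
      exact hy ▸ h3
    · refine (h1.not_singleton htf neK (u := H) fun x hx => ?_).elim
      obtain ⟨y, hy, h3⟩ := j₁ x hx
      rw [h2] at hy
      exact hy ▸ h3
    · exact h1.union hcol h2 hdisj j₁ j₂

section Colouring

variable {V : Type*} {G : SimpleGraph V}

/-- `x` and `y` are opposite vertices of an alternating `4`-cycle. -/
def Opposite (G : SimpleGraph V) (x y : V) : Prop := ∃ b d, AlternatingCycle G x b y d

theorem Opposite.symm {x y : V} (h : Opposite G x y) : Opposite G y x := by
  obtain ⟨b, d, h⟩ := h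
  exact ⟨d, b, h.rotate⟩

theorem Opposite.of_ncard_eq [Finite V] (hG : Rigid G) {a c z : V} (h : Opposite G a c)
    (hza : z ≠ a) (hdeg : (G.neighborSet z).ncard = (G.neighborSet a).ncard) :
    Opposite G a z := by
  by_cases hzc : z = c
  · exact hzc ▸ h
  by_contra hno
  have key : ∀ q, q ≠ a → q ≠ z → (G.Adj q a ↔ G.Adj q z) := by
    intro q hqa hqz
    by_contra hne
    by_cases hq : G.Adj q a
    · obtain ⟨e, he⟩ := exists_alternatingCycle_of_ncard_le hq (by tauto) hqz hdeg.ge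
      exact hno ⟨_, _, he.reflect⟩
    · obtain ⟨e, he⟩ := exists_alternatingCycle_of_ncard_le (p := q) (b := z) (by tauto) hq hqa
        hdeg.le
      exact hno (Opposite.symm ⟨_, _, he.reflect⟩)
  obtain ⟨b, d, h⟩ := h
  have hac := h.ne_ac
  have hbd := h.ne_bd
  have hdiag := hG.diag _ _ _ _ h
  have hz := fun h1 h2 h3 => hG.adj_iff' h (v := z) hza h1 h2 h3
  obtain ⟨h3, h4, h5, h6, h7, h8⟩ := h
  by_cases hzb : z = b
  · subst hzb
    have h9 : ¬ G.Adj a c := fun e => h8 ((key c hac.symm (Ne.symm hzc)).1 e.symm).symm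
    have h10 : ¬ G.Adj z d := fun e => h7 ((key d h3.symm hbd.symm).2 e.symm).symm
    exact h9 (hdiag.2 h10)
  by_cases hzd : z = d
  · subst hzd
    have h9 : G.Adj a c := ((key c hac.symm h6.ne).2 h6).symm
    have h10 : G.Adj b z := (key b h5.ne' hbd).1 h5.symm
    exact hdiag.1 h9 h10
  · have h9 : G.Adj z b := ((key b h5.ne' (Ne.symm hzb)).1 h5.symm).symm
    exact h7 ((key d h3.symm (Ne.symm hzd)).2 ((hz hzb hzc hzd).1 h9).symm).symm

theorem Rigid.alternatingCycle_unique (hG : Rigid G) {a b c d b' d' : V}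
    (h : AlternatingCycle G a b c d) (h' : AlternatingCycle G a b' c d') : b = b' ∧ d = d' :=
  ⟨hG.eq_of_adj_of_not_adj h'.reflect h.2.2.1.symm h.2.2.2.2.2 h.2.1,
    hG.eq_of_adj_of_not_adj h'.rotate.reflect h.2.2.2.1.symm (fun e => h.2.2.2.2.1 e.symm)
      h.1.symm⟩

theorem two_mul_card_filter {ι : Type*} (s : Finset ι) (r : ι → ι) (hr : ∀ x ∈ s, r x ∈ s)
    (hrr : ∀ x, r (r x) = x) (g h : ι → Prop) [DecidablePred g] [DecidablePred h]
    (hg : ∀ x ∈ s, (g (r x) ↔ g x)) (hh : ∀ x ∈ s, (h (r x) ↔ ¬ h x)) :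
    2 * (s.filter fun x => h x ∧ g x).card = (s.filter g).card := by
  have h1 : (s.filter fun x => h x ∧ g x).card = (s.filter fun x => ¬ h x ∧ g x).card := by
    refine Finset.card_nbij' r r ?_ ?_ (fun x _ => hrr x) (fun x _ => hrr x)
    · intro x hx
      simp only [Finset.coe_filter, Set.mem_ofPred_eq] at hx ⊢
      have := hg x hx.1
      have := hh x hx.1
      exact ⟨hr x hx.1, by tauto⟩
    · intro x hx
      simp only [Finset.coe_filter, Set.mem_ofPred_eq] at hx ⊢
      have := hg x hx.1
      have := hh x hx.1
      exact ⟨hr x hx.1, by tauto⟩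
  have h2 := Finset.card_filter_add_card_filter_not (s := s.filter g) h
  rw [Finset.filter_filter, Finset.filter_filter] at h2
  simp only [and_comm (a := g _)] at h2
  omega

variable [Fintype V]

open Classical in
/-- The quadruples `(a, b, c, d)` such that `b, a, c, d` is an induced path in `G`, provided
that `G` is rigid. -/
noncomputable def inducedPaths (G : SimpleGraph V) : Finset (V × V × V × V) :=
  Finset.univ.filter fun P =>
    AlternatingCycle G P.1 P.2.1 P.2.2.1 P.2.2.2 ∧ G.Adj P.1 P.2.2.1

theorem mem_inducedPaths {P : V × V × V × V} : P ∈ inducedPaths G ↔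
    AlternatingCycle G P.1 P.2.1 P.2.2.1 P.2.2.2 ∧ G.Adj P.1 P.2.2.1 := by
  simp [inducedPaths]

theorem card_filter_inducedPaths_comm (g h k : V × V × V × V → Prop) [DecidablePred g]
    [DecidablePred h] [DecidablePred k]
    (hg : ∀ a b c d, AlternatingCycle G a b c d → (g (c, d, a, b) ↔ g (a, b, c, d)))
    (hh : ∀ a b c d, AlternatingCycle G a b c d → (h (c, d, a, b) ↔ ¬ h (a, b, c, d)))
    (hk : ∀ a b c d, AlternatingCycle G a b c d → (k (c, d, a, b) ↔ ¬ k (a, b, c, d))) :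
    ((inducedPaths G).filter fun P => h P ∧ g P).card =
      ((inducedPaths G).filter fun P => k P ∧ g P).card := by
  have hr : ∀ P ∈ inducedPaths G, (P.2.2.1, P.2.2.2, P.1, P.2.1) ∈ inducedPaths G := by
    intro P hP
    rw [mem_inducedPaths] at hP ⊢
    exact ⟨hP.1.rotate, hP.2.symm⟩
  have h1 := two_mul_card_filter (inducedPaths G) (fun P => (P.2.2.1, P.2.2.2, P.1, P.2.1)) hr
    (fun _ => rfl) g h (fun P hP => hg _ _ _ _ (mem_inducedPaths.1 hP).1)
    (fun P hP => hh _ _ _ _ (mem_inducedPaths.1 hP).1)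
  have h2 := two_mul_card_filter (inducedPaths G) (fun P => (P.2.2.1, P.2.2.2, P.1, P.2.1)) hr
    (fun _ => rfl) g k (fun P hP => hg _ _ _ _ (mem_inducedPaths.1 hP).1)
    (fun P hP => hk _ _ _ _ (mem_inducedPaths.1 hP).1)
  omega

variable [LinearOrder V]

/-- The number of inversions between the two pairs of opposite vertices of induced paths. -/
noncomputable def inversionCount (G : SimpleGraph V) : ℕ :=
  ((inducedPaths G).filter fun P => P.1 < P.2.2.1 ∧ P.2.2.2 < P.2.1).card

theorem inversionCount_of_iso {G' : SimpleGraph V} (τ : Equiv.Perm V)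
    (hτ : ∀ x y, G'.Adj (τ x) (τ y) ↔ G.Adj x y) :
    inversionCount G' = ((inducedPaths G).filter fun P =>
      τ P.1 < τ P.2.2.1 ∧ τ P.2.2.2 < τ P.2.1).card := by
  symm
  refine Finset.card_equiv (τ.prodCongr (τ.prodCongr (τ.prodCongr τ))) fun P => ?_
  simp [mem_inducedPaths, AlternatingCycle, hτ]

open Classical in
theorem even_inversionCount_add {G' : SimpleGraph V} (τ : Equiv.Perm V)
    (hτ : ∀ x y, G'.Adj (τ x) (τ y) ↔ G.Adj x y) :
    Even (inversionCount G + inversionCount G' +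
      (((inducedPaths G).filter fun P => P.1 < P.2.2.1 ∧ τ P.2.2.1 < τ P.1).card +
      ((inducedPaths G).filter fun P => P.2.1 < P.2.2.2 ∧ τ P.2.2.2 < τ P.2.1).card)) := by
  have flip : ∀ x y : V, x ≠ y → (y < x ↔ ¬ x < y) := fun x y h => by
    rw [not_lt]; exact ⟨le_of_lt, fun h' => lt_of_le_of_ne h' h.symm⟩
  have h1 : inversionCount G = ((inducedPaths G).filter fun P => P.1 < P.2.2.1 ∧
      ¬ (P.1 < P.2.2.1 ↔ P.2.1 < P.2.2.2)).card := by
    refine congrArg Finset.card (Finset.filter_congr fun P hP => ?_)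
    have h := (mem_inducedPaths.1 hP).1
    have := flip _ _ h.ne_bd
    tauto
  have h2 : inversionCount G' = ((inducedPaths G).filter fun P => P.1 < P.2.2.1 ∧
      ¬ (τ P.1 < τ P.2.2.1 ↔ τ P.2.1 < τ P.2.2.2)).card := by
    rw [inversionCount_of_iso τ hτ]
    refine (congrArg Finset.card (Finset.filter_congr fun P hP => ?_)).trans
      (card_filter_inducedPaths_comm
        (fun P => ¬ (τ P.1 < τ P.2.2.1 ↔ τ P.2.1 < τ P.2.2.2)) (fun P => τ P.1 < τ P.2.2.1)
        (fun P => P.1 < P.2.2.1) ?_ ?_ ?_)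
    · have h := (mem_inducedPaths.1 hP).1
      have := flip _ _ (τ.injective.ne h.ne_bd)
      tauto
    · intro a b c d h
      have := flip _ _ (τ.injective.ne h.ne_bd)
      have := flip _ _ (τ.injective.ne h.ne_ac)
      tauto
    · intro a b c d h
      exact flip _ _ (τ.injective.ne h.ne_ac)
    · intro a b c d h
      exact flip _ _ h.ne_ac
  have h3 : ((inducedPaths G).filter fun P => P.1 < P.2.2.1 ∧ τ P.2.2.1 < τ P.1).card =
      ((inducedPaths G).filter fun P => P.1 < P.2.2.1 ∧
        ¬ (P.1 < P.2.2.1 ↔ τ P.1 < τ P.2.2.1)).card := by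
    refine congrArg Finset.card (Finset.filter_congr fun P hP => ?_)
    have h := (mem_inducedPaths.1 hP).1
    have := flip _ _ (τ.injective.ne h.ne_ac)
    tauto
  have h4 : ((inducedPaths G).filter fun P => P.2.1 < P.2.2.2 ∧ τ P.2.2.2 < τ P.2.1).card =
      ((inducedPaths G).filter fun P => P.1 < P.2.2.1 ∧
        ¬ (P.2.1 < P.2.2.2 ↔ τ P.2.1 < τ P.2.2.2)).card := by
    refine (congrArg Finset.card (Finset.filter_congr fun P hP => ?_)).trans
      (card_filter_inducedPaths_comm
        (fun P => ¬ (P.2.1 < P.2.2.2 ↔ τ P.2.1 < τ P.2.2.2)) (fun P => P.2.1 < P.2.2.2)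
        (fun P => P.1 < P.2.2.1) ?_ ?_ ?_)
    · have h := (mem_inducedPaths.1 hP).1
      have := flip _ _ (τ.injective.ne h.ne_bd)
      tauto
    · intro a b c d h
      have := flip _ _ (τ.injective.ne h.ne_bd)
      have := flip _ _ h.ne_bd
      tauto
    · intro a b c d h
      exact flip _ _ h.ne_bd
    · intro a b c d h
      exact flip _ _ h.ne_ac
  rw [h1, h2, h3, h4]
  simp only [← Finset.filter_filter]
  simp only [Finset.card_filter _ (Finset.filter _ _), ← Finset.sum_add_distrib]
  refine Finset.even_sum _ fun P hP => ?_
  by_cases c1 : P.1 < P.2.2.1 <;> by_cases c2 : P.2.1 < P.2.2.2 <;>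
    by_cases c3 : τ P.1 < τ P.2.2.1 <;> by_cases c4 : τ P.2.1 < τ P.2.2.2 <;>
    simp [c1, c2, c3, c4] <;> decide

open Classical in
theorem card_filter_add_card_filter_eq (hG : Rigid G) (τ : Equiv.Perm V) :
    ((inducedPaths G).filter fun P => P.1 < P.2.2.1 ∧ τ P.2.2.1 < τ P.1).card +
      ((inducedPaths G).filter fun P => P.2.1 < P.2.2.2 ∧ τ P.2.2.2 < τ P.2.1).card =
    (Finset.univ.filter fun e : V × V =>
      e.1 < e.2 ∧ τ e.2 < τ e.1 ∧ Opposite G e.1 e.2).card := by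
  rw [← Finset.card_filter_add_card_filter_not
    (s := Finset.univ.filter fun e : V × V => e.1 < e.2 ∧ τ e.2 < τ e.1 ∧ Opposite G e.1 e.2)
    (fun e => G.Adj e.1 e.2)]
  congr 1
  · refine Finset.card_bij (fun P _ => (P.1, P.2.2.1)) ?_ ?_ ?_
    · intro P hP
      simp only [Finset.mem_filter, mem_inducedPaths, Finset.mem_univ, true_and] at hP ⊢
      exact ⟨⟨hP.2.1, hP.2.2, _, _, hP.1.1⟩, hP.1.2⟩
    · rintro ⟨a, b, c, d⟩ hP ⟨a', b', c', d'⟩ hP' heq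
      simp only [Finset.mem_filter, mem_inducedPaths, Prod.mk.injEq] at hP hP' heq ⊢
      obtain ⟨rfl, rfl⟩ := heq
      obtain ⟨rfl, rfl⟩ := hG.alternatingCycle_unique hP.1.1 hP'.1.1
      simp
    · rintro ⟨x, y⟩ he
      simp only [Finset.mem_filter, Finset.mem_univ, true_and] at he
      obtain ⟨⟨h1, h2, b, d, h3⟩, h4⟩ := he
      exact ⟨(x, b, y, d), by simp [mem_inducedPaths, *], rfl⟩
  · refine Finset.card_bij (fun P _ => (P.2.1, P.2.2.2)) ?_ ?_ ?_
    · intro P hP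
      simp only [Finset.mem_filter, mem_inducedPaths, Finset.mem_univ, true_and] at hP ⊢
      exact ⟨⟨hP.2.1, hP.2.2, _, _, hP.1.1.reflect⟩, (hG.diag _ _ _ _ hP.1.1).1 hP.1.2⟩
    · rintro ⟨a, b, c, d⟩ hP ⟨a', b', c', d'⟩ hP' heq
      simp only [Finset.mem_filter, mem_inducedPaths, Prod.mk.injEq] at hP hP' heq ⊢
      obtain ⟨rfl, rfl⟩ := heq
      obtain ⟨rfl, rfl⟩ := hG.alternatingCycle_unique hP.1.1.reflect hP'.1.1.reflect
      simp
    · rintro ⟨x, y⟩ he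
      simp only [Finset.mem_filter, Finset.mem_univ, true_and] at he
      obtain ⟨⟨h1, h2, b, d, h3⟩, h4⟩ := he
      have h5 := (hG.diag _ _ _ _ h3.reflect).2 h4
      exact ⟨(b, x, d, y), by simp [mem_inducedPaths, h1, h2, h3.reflect, h5], rfl⟩

open Classical in
theorem odd_card_filter_opposite (hG : Rigid G) {a c : V} (h : Opposite G a c) :
    Odd (Finset.univ.filter fun e : V × V => e.1 < e.2 ∧
      Equiv.swap a c e.2 < Equiv.swap a c e.1 ∧ Opposite G e.1 e.2).card := by
  wlog hlt : a < c generalizing a c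
  · have hne : a ≠ c := by obtain ⟨_, _, h⟩ := h; exact h.ne_ac
    have := this h.symm (lt_of_le_of_ne (not_lt.1 hlt) hne.symm)
    rwa [Equiv.swap_comm] at this
  have hdeg : ∀ x y, Opposite G x y → (G.neighborSet x).ncard = (G.neighborSet y).ncard :=
    fun x y ⟨_, _, h⟩ => hG.ncard_eq h
  have hcls : ∀ x y, x ≠ y → (G.neighborSet x).ncard = (G.neighborSet a).ncard →
      (G.neighborSet y).ncard = (G.neighborSet a).ncard → Opposite G x y := by
    intro x y hxy hx hy
    by_cases hxa : x = a
    · subst hxa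
      exact h.of_ncard_eq hG hxy.symm hy
    · exact (h.of_ncard_eq hG hxa hx).symm.of_ncard_eq hG hxy.symm (hy.trans hx.symm)
  have hac := hdeg a c h
  have hswap : ∀ x, (G.neighborSet (Equiv.swap a c x)).ncard = (G.neighborSet x).ncard := by
    intro x
    rw [Equiv.swap_apply_def]
    split_ifs with h1 h2
    · rw [h1, hac]
    · rw [h2, hac]
    · rfl
  have hmem : (a, c) ∈ Finset.univ.filter fun e : V × V => e.1 < e.2 ∧
      Equiv.swap a c e.2 < Equiv.swap a c e.1 ∧ Opposite G e.1 e.2 := by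
    simp [hlt, h]
  rw [← Finset.card_erase_add_one hmem]
  apply Even.add_one
  rw [← ZMod.natCast_eq_zero_iff_even, Finset.cast_card]
  refine Finset.sum_involution (fun e _ => (Equiv.swap a c e.2, Equiv.swap a c e.1)) ?_ ?_ ?_ ?_
  · intros; decide
  · rintro ⟨x, y⟩ he _ heq
    simp only [Finset.mem_erase, Finset.mem_filter, Finset.mem_univ, true_and, ne_eq,
      Prod.mk.injEq] at he heq
    have h1 := heq.1
    rw [Equiv.swap_apply_def] at h1
    split_ifs at h1 with h2 h3
    · subst h1 h2; exact lt_asymm hlt he.2.1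
    · subst h1 h3; exact he.1 ⟨rfl, rfl⟩
    · exact he.2.1.ne h1.symm
  · rintro ⟨x, y⟩ he
    simp only [Finset.mem_erase, Finset.mem_filter, Finset.mem_univ, true_and, ne_eq,
      Prod.mk.injEq, Equiv.swap_apply_self] at he ⊢
    obtain ⟨h1, h2, h3, h4⟩ := he
    refine ⟨fun h5 => h1 ?_, h3, h2, ?_⟩
    · rw [← Equiv.swap_apply_self a c x, ← Equiv.swap_apply_self a c y, h5.1, h5.2]
      simp
    · have hx : (G.neighborSet x).ncard = (G.neighborSet a).ncard := by
        by_contra hx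
        have hy : (G.neighborSet y).ncard ≠ (G.neighborSet a).ncard := by
          rwa [← hdeg x y h4]
        rw [Equiv.swap_apply_of_ne_of_ne, Equiv.swap_apply_of_ne_of_ne] at h3
        · exact lt_asymm h2 h3
        · rintro rfl; exact hx rfl
        · rintro rfl; exact hx hac.symm
        · rintro rfl; exact hy rfl
        · rintro rfl; exact hy hac.symm
      apply hcls _ _ h3.ne
      · rw [hswap, ← hdeg x y h4, hx]
      · rw [hswap, hx]
  · rintro ⟨x, y⟩ _
    simp

theorem Rigid.even_inversionCount_switch_iff (hG : Rigid G) {a b c d : V}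
    (h : AlternatingCycle G a b c d) :
    ¬ (Even (inversionCount G) ↔ Even (inversionCount (switch G a b c d))) := by
  classical
  have h1 := even_inversionCount_add (Equiv.swap a c) (hG.switch_adj_swap h)
  rw [card_filter_add_card_filter_eq hG, Nat.even_add, Nat.even_add] at h1
  have h2 := odd_card_filter_opposite hG ⟨b, d, h⟩
  rw [← Nat.not_even_iff_odd] at h2
  tauto

end Colouring

theorem Laceable.complete_or_hamiltonian {α : Type*} [DecidableEq α] {Γ : SimpleGraph α}
    {col : α → Prop} (hcol : ∀ x y, Γ.Adj x y → ¬ (col x ↔ col y)) [Nonempty α]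
    (h : Laceable Γ col Set.univ) :
    Nonempty (Γ ≃g (⊤ : SimpleGraph (Fin 2))) ∨
      ∃ (x : α) (p : Γ.Walk x x), p.IsHamiltonianCycle := by
  obtain ⟨x, -, v, -, hxv⟩ := h.exists_adj Set.univ_nonempty
  have hc := hcol _ _ hxv.symm
  obtain ⟨p, hp, hpS⟩ := h.exists_path v trivial x trivial hc
  by_cases hedge : s(x, v) ∈ p.edges
  · left
    have htwo : ∀ z, z = x ∨ z = v := by
      cases p with
      | nil => exact absurd rfl hxv.ne
      | @cons _ w _ hadj t =>
        rw [SimpleGraph.Walk.cons_isPath_iff] at hp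
        rw [SimpleGraph.Walk.edges_cons, List.mem_cons] at hedge
        rcases hedge with hedge | hedge
        · obtain rfl : w = x := by
            rw [Sym2.eq_iff] at hedge
            rcases hedge with h | h
            · exact absurd h.1 hxv.ne
            · exact h.1.symm
          obtain rfl := (SimpleGraph.Walk.isPath_iff_nil.1 hp.1).eq_nil
          intro z
          have := hpS z
          simpa [or_comm] using this
        · exact absurd (t.snd_mem_support_of_mem_edges hedge) hp.2
    refine ⟨⟨⟨fun z => if z = x then 0 else 1, ![x, v], ?_, ?_⟩, ?_⟩⟩
    · intro z
      rcases htwo z with rfl | rfl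
      · simp
      · simp [hxv.ne']
    · intro i
      fin_cases i
      · simp
      · simp [hxv.ne']
    · intro y z
      rcases htwo y with rfl | rfl <;> rcases htwo z with rfl | rfl <;>
        simp [hxv.ne', hxv, hxv.symm]
  · right
    refine ⟨x, .cons hxv p, ⟨(SimpleGraph.Walk.cons_isCycle_iff _ _).2 ⟨hp, hedge⟩, ?_⟩⟩
    refine SimpleGraph.Walk.IsPath.isHamiltonian_of_mem ?_ ?_
    · simpa using hp
    · intro w
      have := (hpS w).2 trivial
      simpa using this

end RealizationGraph

open Classical in
theorem mainTheorem4 (n : ℕ) (hn : 1 ≤ n) (d : Fin n → ℕ)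
    (hd : RealizationGraph.IsDegreeSequence d)
    (htf : (RealizationGraph.realizationGraph d).CliqueFree 3) :
    Nonempty (RealizationGraph.realizationGraph d ≃g (⊤ : SimpleGraph (Fin 1))) ∨
    Nonempty (RealizationGraph.realizationGraph d ≃g (⊤ : SimpleGraph (Fin 2))) ∨
    ∃ (G : RealizationGraph.Realization d) (p : (RealizationGraph.realizationGraph d).Walk G G),
      p.IsHamiltonianCycle := by
  obtain ⟨K⟩ := hd.2
  have : Nonempty (RealizationGraph.Realization d) := ⟨K⟩
  have hcol : ∀ G H, (RealizationGraph.realizationGraph d).Adj G H →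
      ¬ (Even (RealizationGraph.inversionCount G.1) ↔
        Even (RealizationGraph.inversionCount H.1)) := by
    intro G H h
    obtain ⟨a, b, c, e, h1, h2⟩ := RealizationGraph.TwoSwitch.exists_alternatingCycle h
    rw [h2]
    exact (G.rigid htf).even_inversionCount_switch_iff h1
  have huniv : RealizationGraph.agreeing 0 K = Set.univ :=
    Set.eq_univ_of_forall fun G p b h => absurd h (Nat.not_lt_zero _)
  rcases RealizationGraph.agreeing_eq_singleton_or_laceable htf hcol (n * n) 0 (by simp) K
    with h | h
  · left
    rw [huniv] at h
    have hsub : ∀ G, G = K := fun G => by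
      have : G ∈ (Set.univ : Set (RealizationGraph.Realization d)) := trivial
      rwa [h] at this
    refine ⟨⟨⟨fun _ => 0, fun _ => K, fun G => (hsub G).symm, fun i => Subsingleton.elim _ _⟩, ?_⟩⟩
    intro G H
    rw [hsub G, hsub H]
    simp
  · rw [huniv] at h
    exact Or.inr (h.complete_or_hamiltonian hcol)
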